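/- Let $Z_1, Z_2, Z_3 \in \mathbb{R}^2$ be pairwise distinct points, let $d_1, d_2, d_3 \in \mathbb{R}$, and put $$O(W) = \sum_{j=1}^{3} \bigl|\, \|W - Z_j\|^2 - d_j^2 \,\bigr| \qquad (W \in \mathbb{R}^2),$$ where $\|\cdot\|$ is the Euclidean norm. Then the set $$X = \operatorname*{argmin}_{W \in \mathbb{R}^2} O(W) = \{\, A \in \mathbb{R}^2 : O(A) \le O(W) \text{ for all } W \in \mathbb{R}^2 \,\}$$ of global minimizers of $O$ is finite and has at most five points. -/

import Mathlib

/-- The objective function `O(W) = ∑ⱼ |‖W - Zⱼ‖² - dⱼ²|` for three sensors `Z` in the Euclidean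
plane and three measured lengths `d`. -/
noncomputable def sourceObjective (Z : Fin 3 → EuclideanSpace ℝ (Fin 2)) (d : Fin 3 → ℝ)
    (W : EuclideanSpace ℝ (Fin 2)) : ℝ :=
  ∑ j : Fin 3, |‖W - Z j‖ ^ 2 - d j ^ 2|

/-- The set of global minimizers of the objective function over the whole plane. -/
def sourceSolutions (Z : Fin 3 → EuclideanSpace ℝ (Fin 2)) (d : Fin 3 → ℝ) :
    Set (EuclideanSpace ℝ (Fin 2)) :=
  {X | ∀ W, sourceObjective Z d X ≤ sourceObjective Z d W}

/-! Put the plane on the paraboloid `t = ‖w‖²`: each residual becomes affine, so the objective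
extends to a convex function F. Let m be its minimum on the paraboloid. A segment from {F ≤ m} to {F
< m} cannot cross the paraboloid, since F would be below m there (`not_opposite_sides`). Three cases
follow. If F ≥ m everywhere, all minimizers share their residuals, hence their distances to each
centre, and two circles meet in at most two points. If F < m somewhere outside, two minimizers would
have a midpoint strictly inside, so there is only one. If F < m somewhere inside, {F ≤ m} is an
octahedron inside the paraboloid; strict convexity allows contact only at its six vertices, and
contact at all six would make the gradient of ‖w‖² - t vanish at the centre. -/

open Set

section Paraboloid

variable {V : Type*} [NormedAddCommGroup V]

/-- The defining function of the paraboloid `t = ‖w‖²`. -/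
def paraboloidFn (p : V × ℝ) : ℝ := ‖p.1‖ ^ 2 - p.2

lemma continuous_paraboloidFn : Continuous (paraboloidFn : V × ℝ → ℝ) := by
  unfold paraboloidFn; fun_prop

lemma paraboloidFn_lift (A : V) : paraboloidFn (A, ‖A‖ ^ 2) = 0 := by simp [paraboloidFn]

lemma eq_lift_of_paraboloidFn_eq_zero {p : V × ℝ} (hp : paraboloidFn p = 0) :
    p = (p.1, ‖p.1‖ ^ 2) := by
  unfold paraboloidFn at hp
  ext
  · rfl
  · simp only; linarith

end Paraboloid

/-! ### Convexity of the lifted objective -/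

section Lifting

variable {V : Type*} [NormedAddCommGroup V] [InnerProductSpace ℝ V]

/-- The linear form `(w, t) ↦ t - 2⟪z, w⟫` on the space containing the paraboloid `t = ‖w‖²`. -/
noncomputable def liftForm (z : V) : V × ℝ →ₗ[ℝ] ℝ where
  toFun p := p.2 - 2 * inner ℝ z p.1
  map_add' p q := by simp only [Prod.fst_add, Prod.snd_add, inner_add_right]; ring
  map_smul' c p := by
    simp only [Prod.smul_fst, Prod.smul_snd, inner_smul_right, smul_eq_mul, RingHom.id_apply]; ring

lemma liftForm_apply (z : V) (p : V × ℝ) : liftForm z p = p.2 - 2 * inner ℝ z p.1 := rfl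

/-- The affine function on `V × ℝ` restricting to `‖W - Z j‖² - d j²` on the paraboloid. -/
noncomputable def liftResidual (Z : Fin 3 → V) (d : Fin 3 → ℝ) (j : Fin 3) (p : V × ℝ) : ℝ :=
  liftForm (Z j) p + (‖Z j‖ ^ 2 - d j ^ 2)

/-- The convex function on `V × ℝ` restricting to the objective function on the paraboloid. -/
noncomputable def liftObjective (Z : Fin 3 → V) (d : Fin 3 → ℝ) (p : V × ℝ) : ℝ :=
  ∑ j, |liftResidual Z d j p|

variable {Z : Fin 3 → V} {d : Fin 3 → ℝ} {m : ℝ}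

lemma liftResidual_add (j : Fin 3) (p v : V × ℝ) :
    liftResidual Z d j (p + v) = liftResidual Z d j p + liftForm (Z j) v := by
  simp only [liftResidual, map_add]; ring

lemma liftResidual_combo (j : Fin 3) (p q : V × ℝ) {a b : ℝ} (hab : a + b = 1) :
    liftResidual Z d j (a • p + b • q) = a * liftResidual Z d j p + b * liftResidual Z d j q := by
  simp only [liftResidual, map_add, map_smul, smul_eq_mul]
  linear_combination (‖Z j‖ ^ 2 - d j ^ 2) * (-hab)

lemma liftObjective_combo_le (p q : V × ℝ) {a b : ℝ} (ha : 0 ≤ a) (hb : 0 ≤ b) (hab : a + b = 1) :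
    liftObjective Z d (a • p + b • q) ≤ a * liftObjective Z d p + b * liftObjective Z d q := by
  simp only [liftObjective, Finset.mul_sum, ← Finset.sum_add_distrib]
  refine Finset.sum_le_sum fun j _ => ?_
  rw [liftResidual_combo j p q hab]
  refine (abs_add_le _ _).trans_eq ?_
  rw [abs_mul, abs_mul, abs_of_nonneg ha, abs_of_nonneg hb]

/-- The last term is the strict convexity defect: it puts chords of the paraboloid strictly inside.
-/
lemma paraboloidFn_combo (p q : V × ℝ) {a b : ℝ} (hab : a + b = 1) :
    paraboloidFn (a • p + b • q) =
      a * paraboloidFn p + b * paraboloidFn q - a * b * ‖p.1 - q.1‖ ^ 2 := by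
  obtain rfl : a = 1 - b := by linarith
  simp only [paraboloidFn, Prod.fst_add, Prod.snd_add, Prod.smul_fst, Prod.smul_snd, smul_eq_mul,
    ← real_inner_self_eq_norm_sq, inner_add_left, inner_add_right, inner_sub_left,
    inner_sub_right, real_inner_smul_left, real_inner_smul_right, real_inner_comm p.1 q.1]
  ring

lemma paraboloidFn_add_smul (p v : V × ℝ) (s : ℝ) : paraboloidFn (p + s • v) =
    paraboloidFn p + s * (2 * inner ℝ p.1 v.1 - v.2) + s ^ 2 * ‖v.1‖ ^ 2 := by
  simp only [paraboloidFn, Prod.fst_add, Prod.snd_add, Prod.smul_fst, Prod.smul_snd,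
    norm_add_sq_real, inner_smul_right, norm_smul, smul_eq_mul, mul_pow, Real.norm_eq_abs, sq_abs]
  ring

/-- If `m` bounds the lifted objective from below on the paraboloid, then its sublevel set at
height `m` does not pass through the paraboloid. -/
lemma not_opposite_sides (hm : ∀ W : V, m ≤ liftObjective Z d (W, ‖W‖ ^ 2)) {p q : V × ℝ}
    (hp : liftObjective Z d p ≤ m) (hq : liftObjective Z d q < m) :
    ¬ paraboloidFn p * paraboloidFn q < 0 := by
  intro h
  have hcont : Continuous fun s : ℝ => paraboloidFn ((1 - s) • p + s • q) :=
    continuous_paraboloidFn.comp (by fun_prop)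
  have hivt := intermediate_value_uIcc (a := (0 : ℝ)) (b := 1) hcont.continuousOn
  have h0 : (0 : ℝ) ∈ uIcc (paraboloidFn p) (paraboloidFn q) := by
    rw [mem_uIcc]
    rcases mul_neg_iff.mp h with h | h
    · exact Or.inr ⟨h.2.le, h.1.le⟩
    · exact Or.inl ⟨h.1.le, h.2.le⟩
  obtain ⟨s, hs, hs0⟩ := hivt (by simpa using h0)
  rw [uIcc_of_le zero_le_one] at hs
  -- A positive weight on `q` makes the convexity bound strict.
  have hspos : 0 < s := by
    refine lt_of_le_of_ne hs.1 ?_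
    rintro rfl
    simp only [sub_zero, one_smul, zero_smul, add_zero] at hs0
    simp [hs0] at h
  have h1 := hm ((1 - s) • p + s • q).1
  rw [← eq_lift_of_paraboloidFn_eq_zero hs0] at h1
  have h2 := liftObjective_combo_le (Z := Z) (d := d) p q (a := 1 - s) (b := s)
    (by linarith [hs.2]) hs.1 (by ring)
  nlinarith [hs.2]

lemma paraboloidFn_ne_zero (hm : ∀ W : V, m ≤ liftObjective Z d (W, ‖W‖ ^ 2)) {q : V × ℝ}
    (hq : liftObjective Z d q < m) : paraboloidFn q ≠ 0 := fun h => by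
  have := hm q.1
  rw [← eq_lift_of_paraboloidFn_eq_zero h] at this
  linarith

/-- The minimizer is unique if the sublevel set reaches outside the paraboloid. -/
lemma minimizer_unique_of_outside (hm : ∀ W : V, m ≤ liftObjective Z d (W, ‖W‖ ^ 2))
    {q : V × ℝ} (hq : liftObjective Z d q < m) (hq0 : 0 < paraboloidFn q) {A B : V}
    (hA : liftObjective Z d (A, ‖A‖ ^ 2) ≤ m) (hB : liftObjective Z d (B, ‖B‖ ^ 2) ≤ m) :
    A = B := by
  by_contra hAB
  have hpos : 0 < ‖A - B‖ := norm_pos_iff.mpr (sub_ne_zero.mpr hAB)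
  set p := (1 / 2 : ℝ) • ((A, ‖A‖ ^ 2) : V × ℝ) + (1 / 2 : ℝ) • (B, ‖B‖ ^ 2)
  have h1 : liftObjective Z d p ≤ m := by
    have := liftObjective_combo_le (Z := Z) (d := d) (A, ‖A‖ ^ 2) (B, ‖B‖ ^ 2)
      (a := 1 / 2) (b := 1 / 2) (by norm_num) (by norm_num) (by norm_num)
    linarith
  have h2 : paraboloidFn p < 0 := by
    have := paraboloidFn_combo ((A, ‖A‖ ^ 2) : V × ℝ) (B, ‖B‖ ^ 2)
      (a := 1 / 2) (b := 1 / 2) (by norm_num)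
    simp only [paraboloidFn_lift] at this
    have := pow_pos hpos 2
    linarith
  exact not_opposite_sides hm h1 hq (mul_neg_of_neg_of_pos h2 hq0)

/-! ### Unconstrained minimizers of the lifted objective -/

lemma sum_fin_three_of_ne {i j k : Fin 3} (hij : i ≠ j) (hik : i ≠ k) (hjk : j ≠ k)
    (f : Fin 3 → ℝ) : ∑ l, f l = f i + f j + f k := by
  rw [Fin.sum_univ_three]
  revert i j k
  have : ∀ i j k : Fin 3, i ≠ j → i ≠ k → j ≠ k → (i = 0 ∧ j = 1 ∧ k = 2) ∨
      (i = 0 ∧ j = 2 ∧ k = 1) ∨ (i = 1 ∧ j = 0 ∧ k = 2) ∨ (i = 1 ∧ j = 2 ∧ k = 0) ∨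
      (i = 2 ∧ j = 0 ∧ k = 1) ∨ (i = 2 ∧ j = 1 ∧ k = 0) := by decide
  intro i j k h1 h2 h3
  rcases this i j k h1 h2 h3 with h | h | h | h | h | h <;> obtain ⟨rfl, rfl, rfl⟩ := h <;> ring

lemma exists_third {i j : Fin 3} (hij : i ≠ j) : ∃ k, i ≠ k ∧ j ≠ k := by
  revert i j; decide

lemma abs_add_eq_of_sign {x v : ℝ} (hv : |v| ≤ |x|) : |x + v| = |x| + SignType.sign x * v := by
  rcases lt_trichotomy x 0 with h | rfl | h
  · rw [abs_of_neg h] at hv ⊢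
    rw [abs_of_nonpos (by linarith [le_abs_self v]), sign_neg h]; simp; ring
  · simp at hv; simp [hv]
  · rw [abs_of_pos h] at hv ⊢
    rw [abs_of_nonneg (by linarith [neg_abs_le v]), sign_pos h]; simp

/-- Two of the three residuals vanish at a global minimizer of the lifted objective. -/
lemma residual_eq_zero_or_of_isMin (hZ : Function.Injective Z) {p : V × ℝ}
    (hp : ∀ q, liftObjective Z d p ≤ liftObjective Z d q) {i j : Fin 3} (hij : i ≠ j) :
    liftResidual Z d i p = 0 ∨ liftResidual Z d j p = 0 := by
  by_contra! h
  obtain ⟨hi, hj⟩ := h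
  obtain ⟨k, hik, hjk⟩ := exists_third hij
  have key : ∀ v : V × ℝ, |liftForm (Z i) v| ≤ |liftResidual Z d i p| →
      |liftForm (Z j) v| ≤ |liftResidual Z d j p| →
      0 ≤ SignType.sign (liftResidual Z d i p) * liftForm (Z i) v +
        SignType.sign (liftResidual Z d j p) * liftForm (Z j) v + |liftForm (Z k) v| := by
    intro v h1 h2
    have h := hp (p + v)
    simp only [liftObjective, sum_fin_three_of_ne hij hik hjk, liftResidual_add,
      abs_add_eq_of_sign h1, abs_add_eq_of_sign h2] at h
    linarith [abs_add_le (liftResidual Z d k p) (liftForm (Z k) v)]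
  have small : ∀ v : V × ℝ, ∃ ε : ℝ, 0 < ε ∧ |liftForm (Z i) (ε • v)| ≤ |liftResidual Z d i p| ∧
      |liftForm (Z j) (ε • v)| ≤ |liftResidual Z d j p| := by
    intro v
    have h1 : ∀ l, liftResidual Z d l p ≠ 0 →
        ∀ᶠ ε : ℝ in nhdsWithin 0 (Ioi 0), |liftForm (Z l) (ε • v)| ≤ |liftResidual Z d l p| := by
      intro l hl
      have : Continuous fun ε : ℝ => |liftForm (Z l) (ε • v)| := by
        simp only [map_smul, smul_eq_mul]; fun_prop
      have := (this.tendsto 0).mono_left (nhdsWithin_le_nhds (s := Ioi 0))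
      exact this.eventually_le_const (by simpa using hl)
    obtain ⟨ε, h1, h2, h3⟩ := ((h1 i hi).and ((h1 j hj).and self_mem_nhdsWithin)).exists
    exact ⟨ε, h3, h1, h2⟩
  -- Equal signs: a vertical move shifts all residuals equally, gaining on two and losing on at most
  -- one.
  by_cases hs : SignType.sign (liftResidual Z d i p) = SignType.sign (liftResidual Z d j p)
  · obtain ⟨ε, hε, h1, h2⟩ :=
      small ((0, -(SignType.sign (liftResidual Z d i p) : ℝ)) : V × ℝ)
    have h := key _ h1 h2
    rw [← hs] at h
    rcases hi.lt_or_gt with h0 | h0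
    · simp [liftForm_apply, sign_neg h0, abs_of_pos hε] at h; linarith
    · simp [liftForm_apply, sign_pos h0, abs_of_pos hε] at h; linarith
  -- Opposite signs: a direction killed by the `k`-th form, with horizontal part along `Z i - Z j`,
  -- is a descent direction.
  · have hne : 0 < ‖Z i - Z j‖ := norm_pos_iff.mpr (sub_ne_zero.mpr (hZ.ne hij))
    have hsum : (SignType.sign (liftResidual Z d j p) : ℝ) =
        -SignType.sign (liftResidual Z d i p) := by
      rcases hi.lt_or_gt with h0 | h0 <;> rcases hj.lt_or_gt with h3 | h3 <;>
        simp_all [sign_neg, sign_pos]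
    have hsq : (SignType.sign (liftResidual Z d i p) : ℝ) *
        SignType.sign (liftResidual Z d i p) = 1 := by
      rcases hi.lt_or_gt with h0 | h0 <;> simp [sign_neg, sign_pos, h0]
    set s : ℝ := ((SignType.sign (liftResidual Z d i p) : SignType) : ℝ)
    obtain ⟨ε, hε, h1, h2⟩ :=
      small (s • (Z i - Z j, 2 * inner ℝ (Z k) (Z i - Z j)) : V × ℝ)
    have h := key _ h1 h2
    have h3 : inner ℝ (Z i) (Z i - Z j) - inner ℝ (Z j) (Z i - Z j) = ‖Z i - Z j‖ ^ 2 := by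
      rw [← inner_sub_left, real_inner_self_eq_norm_sq]
    rw [hsum] at h
    simp only [map_smul, smul_eq_mul, liftForm_apply, sub_self, mul_zero, abs_zero] at h
    have h4 : 0 ≤ (s * s) * (ε * (-2 * ‖Z i - Z j‖ ^ 2)) := by rw [← h3]; linarith
    rw [hsq] at h4
    nlinarith [pow_pos hne 2, mul_pos hε (pow_pos hne 2)]

/-- All global minimizers of the lifted objective have the same residuals. -/
lemma residual_eq_of_isMin (hZ : Function.Injective Z) {p q : V × ℝ}
    (hp : ∀ r, liftObjective Z d p ≤ liftObjective Z d r)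
    (hq : ∀ r, liftObjective Z d q ≤ liftObjective Z d r) (i : Fin 3) :
    liftResidual Z d i p = liftResidual Z d i q := by
  -- The midpoint is again a minimizer, so it too has at most one nonzero residual.
  set r := (1 / 2 : ℝ) • p + (1 / 2 : ℝ) • q
  have hr : ∀ x, liftObjective Z d r ≤ liftObjective Z d x := by
    intro x
    have := liftObjective_combo_le (Z := Z) (d := d) p q
      (a := 1 / 2) (b := 1 / 2) (by norm_num) (by norm_num) (by norm_num)
    linarith [hp x, hq x]
  have hmid : ∀ l, liftResidual Z d l r =
      1 / 2 * liftResidual Z d l p + 1 / 2 * liftResidual Z d l q := fun l =>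
    liftResidual_combo l p q (by norm_num)
  obtain ⟨j, hij⟩ := exists_ne i
  obtain ⟨k, hik, hjk⟩ := exists_third hij.symm
  have hval : liftObjective Z d p = liftObjective Z d q := le_antisymm (hp q) (hq p)
  have hval' : liftObjective Z d r = liftObjective Z d q := le_antisymm (hr q) (hq r)
  simp only [liftObjective, sum_fin_three_of_ne hij.symm hik hjk] at hval hval'
  have a1 := residual_eq_zero_or_of_isMin hZ hp hij.symm
  have a2 := residual_eq_zero_or_of_isMin hZ hp hik
  have b1 := residual_eq_zero_or_of_isMin hZ hq hij.symm
  have b2 := residual_eq_zero_or_of_isMin hZ hq hik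
  have c1 := residual_eq_zero_or_of_isMin hZ hr hij.symm
  have c2 := residual_eq_zero_or_of_isMin hZ hr hik
  have m1 := hmid i
  have m2 := hmid j
  have m3 := hmid k
  by_contra hne
  have aux : ∀ {x y : ℝ}, |x| = |y| → x ≠ y → 1 / 2 * x + 1 / 2 * y = 0 := by
    intro x y h hxy
    rcases abs_eq_abs.mp h with h | h
    · exact absurd h hxy
    · rw [h]; ring
  rcases eq_or_ne (liftResidual Z d i p) 0 with hx | hx <;>
  rcases eq_or_ne (liftResidual Z d i q) 0 with hy | hy
  · exact hne (hx.trans hy.symm)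
  · have y2 := b1.resolve_left hy
    have y3 := b2.resolve_left hy
    have hr0 : liftResidual Z d i r ≠ 0 := by rw [m1, hx]; simpa using hy
    have x2 : liftResidual Z d j p = 0 := by
      have := c1.resolve_left hr0; rw [m2, y2] at this; linarith
    have x3 : liftResidual Z d k p = 0 := by
      have := c2.resolve_left hr0; rw [m3, y3] at this; linarith
    simp [hx, x2, x3, y2, y3] at hval
    exact hy (abs_eq_zero.mp hval.symm)
  · have y2 := a1.resolve_left hx
    have y3 := a2.resolve_left hx
    have hr0 : liftResidual Z d i r ≠ 0 := by rw [m1, hy]; simpa using hx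
    have x2 : liftResidual Z d j q = 0 := by
      have := c1.resolve_left hr0; rw [m2, y2] at this; linarith
    have x3 : liftResidual Z d k q = 0 := by
      have := c2.resolve_left hr0; rw [m3, y3] at this; linarith
    simp [hy, x2, x3, y2, y3] at hval
    exact hx hval
  -- Only the `i`-th residuals survive, with equal modulus; if opposite, the midpoint would have
  -- value zero.
  · rw [a1.resolve_left hx, a2.resolve_left hx, b1.resolve_left hy, b2.resolve_left hy] at hval
    rw [m1, m2, m3, a1.resolve_left hx, a2.resolve_left hx, b1.resolve_left hy,
      b2.resolve_left hy] at hval'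
    simp only [abs_zero, add_zero] at hval
    rw [aux hval hne] at hval'
    simp at hval'
    exact hy (abs_eq_zero.mp hval'.symm)

/-! ### Sublevel sets inside the paraboloid -/

/-- The lifted forms separate points if the sublevel set has a point and lies inside the
paraboloid: otherwise it would contain a horizontal line. -/
lemma liftForm_injective (hm : ∀ W : V, m ≤ liftObjective Z d (W, ‖W‖ ^ 2)) {q : V × ℝ}
    (hq : liftObjective Z d q < m) (hq0 : paraboloidFn q < 0) :
    Function.Injective (LinearMap.pi fun j => liftForm (Z j)) := by
  rw [injective_iff_map_eq_zero]
  intro v hv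
  have hv' : ∀ j, liftForm (Z j) v = 0 := fun j => congrFun hv j
  by_contra hne
  have hv1 : v.1 ≠ 0 := by
    intro h
    have := hv' 0
    rw [liftForm_apply, h, inner_zero_right] at this
    exact hne (Prod.ext h (by simpa using this))
  have hle : ∀ s : ℝ, paraboloidFn (q + s • v) ≤ 0 := by
    intro s
    have h1 : liftObjective Z d (q + s • v) = liftObjective Z d q := by
      simp [liftObjective, liftResidual_add, hv']
    by_contra! h
    exact not_opposite_sides hm (h1.trans_lt hq).le hq (mul_neg_of_pos_of_neg h hq0)
  have hpos : 0 < ‖v.1‖ ^ 2 := pow_pos (norm_pos_iff.mpr hv1) 2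
  set N := ‖v.1‖ ^ 2
  set b := 2 * inner ℝ q.1 v.1 - v.2
  set c := paraboloidFn q
  have hs : ∀ s : ℝ, c + s * b + s ^ 2 * N ≤ 0 := fun s => paraboloidFn_add_smul q v s ▸ hle s
  -- Adding the bounds at `s` and `-s` cancels `b`; this `s` is large enough that `c + s ^ 2 * N >
  -- 0`.
  have h1 := hs ((1 - c) / N + 1)
  have h2 := hs (-((1 - c) / N + 1))
  have hx : 0 < (1 - c) / N := div_pos (by linarith) hpos
  have hxN : (1 - c) / N * N = 1 - c := div_mul_cancel₀ _ hpos.ne'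
  set x := (1 - c) / N
  nlinarith [mul_pos hx (mul_pos hx hpos), mul_pos hx hpos]

/-- If the sublevel set lies inside the paraboloid, at most one residual is nonzero at a
point where the two touch. -/
lemma residual_eq_zero_or_of_inside (hm : ∀ W : V, m ≤ liftObjective Z d (W, ‖W‖ ^ 2))
    {q : V × ℝ} (hq : liftObjective Z d q < m) (hq0 : paraboloidFn q < 0)
    {e : Fin 3 → V × ℝ} (he : ∀ i j, liftForm (Z i) (e j) = if i = j then 1 else 0)
    {p : V × ℝ} (hp : liftObjective Z d p ≤ m) (hp0 : paraboloidFn p = 0)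
    {i j : Fin 3} (hij : i ≠ j) :
    liftResidual Z d i p = 0 ∨ liftResidual Z d j p = 0 := by
  by_contra! h
  obtain ⟨hi, hj⟩ := h
  obtain ⟨k, hik, hjk⟩ := exists_third hij
  have hin : ∀ x, liftObjective Z d x ≤ m → paraboloidFn x ≤ 0 := fun x hx => by
    by_contra! h
    exact not_opposite_sides hm hx hq (mul_neg_of_pos_of_neg h hq0)
  have hsq : ∀ x : ℝ, x ≠ 0 → (SignType.sign x : ℝ) * SignType.sign x = 1 := by
    intro x hx
    rcases hx.lt_or_gt with h0 | h0 <;> simp [sign_neg, sign_pos, h0]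
  have habs : ∀ x : ℝ, x ≠ 0 → |(SignType.sign x : ℝ)| = 1 := by
    intro x hx
    rcases hx.lt_or_gt with h0 | h0 <;> simp [sign_neg, sign_pos, h0]
  have hsi := hsq _ hi
  have hsj := hsq _ hj
  have hai := habs _ hi
  have haj := habs _ hj
  set ε := min |liftResidual Z d i p| |liftResidual Z d j p|
  have hε : 0 < ε := lt_min (abs_pos.mpr hi) (abs_pos.mpr hj)
  -- Along `v` one absolute residual grows as fast as the other shrinks, so the objective is
  -- constant up to `±ε`. A segment inside the paraboloid cannot touch it at its midpoint.
  set v : V × ℝ := (SignType.sign (liftResidual Z d i p) : ℝ) • e i -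
    (SignType.sign (liftResidual Z d j p) : ℝ) • e j with hv
  have hvi : liftForm (Z i) v = SignType.sign (liftResidual Z d i p) := by
    simp [hv, he, hij]
  have hvj : liftForm (Z j) v = -SignType.sign (liftResidual Z d j p) := by
    simp [hv, he, hij.symm]
  have hvk : liftForm (Z k) v = 0 := by
    simp [hv, he, hik.symm, hjk.symm]
  have hF : ∀ s : ℝ, |s| ≤ ε → liftObjective Z d (p + s • v) ≤ m := by
    intro s hs
    refine le_trans (le_of_eq ?_) hp
    simp only [liftObjective, sum_fin_three_of_ne hij hik hjk, liftResidual_add, map_smul,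
      smul_eq_mul, hvi, hvj, hvk, mul_zero, add_zero]
    rw [abs_add_eq_of_sign, abs_add_eq_of_sign]
    · linear_combination s * hsi - s * hsj
    · rw [abs_mul, abs_neg, haj, mul_one]; exact hs.trans (min_le_right _ _)
    · rw [abs_mul, hai, mul_one]; exact hs.trans (min_le_left _ _)
  have h1 := hin _ (hF ε (abs_of_pos hε).le)
  have h2 := hin _ (hF (-ε) (by rw [abs_neg]; exact (abs_of_pos hε).le))
  rw [paraboloidFn_add_smul, hp0] at h1 h2
  have hN : ‖v.1‖ ^ 2 = 0 := by
    have := pow_pos hε 2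
    nlinarith [sq_nonneg ‖v.1‖]
  have hv1 : v.1 = 0 := by simpa using hN
  rw [hv1] at h1 h2
  simp at h1 h2
  have hv2 : v.2 = 0 := by nlinarith
  have : v = 0 := Prod.ext hv1 hv2
  rw [this, map_zero] at hvi
  rw [← hvi] at hai
  simp at hai

end Lifting

/-! ### Counting minimizers in the plane -/

lemma liftResidual_lift (Z : Fin 3 → EuclideanSpace ℝ (Fin 2)) (d : Fin 3 → ℝ) (j : Fin 3)
    (W : EuclideanSpace ℝ (Fin 2)) :
    liftResidual Z d j (W, ‖W‖ ^ 2) = ‖W - Z j‖ ^ 2 - d j ^ 2 := by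
  rw [liftResidual, liftForm_apply, norm_sub_sq_real, real_inner_comm]; ring

lemma sourceObjective_eq (Z : Fin 3 → EuclideanSpace ℝ (Fin 2)) (d : Fin 3 → ℝ)
    (W : EuclideanSpace ℝ (Fin 2)) :
    sourceObjective Z d W = liftObjective Z d (W, ‖W‖ ^ 2) := by
  simp only [sourceObjective, liftObjective, liftResidual_lift]

/-- If the minimizers also minimize the lifted objective on the whole space, they lie on the
intersection of circles with distinct centres. -/
lemma encard_sourceSolutions_le_two {Z : Fin 3 → EuclideanSpace ℝ (Fin 2)}
    (hZ : Function.Injective Z) {d : Fin 3 → ℝ}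
    (h : ∀ A ∈ sourceSolutions Z d, ∀ q, liftObjective Z d (A, ‖A‖ ^ 2) ≤ liftObjective Z d q) :
    (sourceSolutions Z d).encard ≤ 2 := by
  have hdist : ∀ A ∈ sourceSolutions Z d, ∀ B ∈ sourceSolutions Z d, ∀ j,
      dist A (Z j) = dist B (Z j) := by
    intro A hA B hB j
    have := residual_eq_of_isMin hZ (h A hA) (h B hB) j
    rw [liftResidual_lift, liftResidual_lift] at this
    rw [dist_eq_norm, dist_eq_norm]
    exact (sq_eq_sq₀ (norm_nonneg _) (norm_nonneg _)).mp (by linarith)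
  rcases (sourceSolutions Z d).subsingleton_or_nontrivial with hs | ⟨A, hA, B, hB, hAB⟩
  · exact (encard_le_one_iff_subsingleton.mpr hs).trans (by norm_num)
  · have hsub : sourceSolutions Z d ⊆ {A, B} := fun C hC =>
      EuclideanGeometry.eq_of_dist_eq_of_dist_eq_of_finrank_eq_two
        (finrank_euclideanSpace_fin (𝕜 := ℝ) (n := 2)) (hZ.ne (show (0 : Fin 3) ≠ 1 by decide)) hAB
        rfl (hdist B hB A hA 0) (hdist C hC A hA 0) rfl (hdist B hB A hA 1) (hdist C hC A hA 1)
    exact (encard_le_encard hsub).trans (encard_pair hAB).le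

/-- If the sublevel set lies inside the paraboloid, it is an octahedron touching the paraboloid
only at vertices, and not at all six of them. -/
lemma encard_sourceSolutions_le_five_of_inside {Z : Fin 3 → EuclideanSpace ℝ (Fin 2)}
    {d : Fin 3 → ℝ} {m : ℝ}
    (hm : ∀ W : EuclideanSpace ℝ (Fin 2), m ≤ liftObjective Z d (W, ‖W‖ ^ 2))
    (hX : ∀ A ∈ sourceSolutions Z d, liftObjective Z d (A, ‖A‖ ^ 2) = m)
    {q : EuclideanSpace ℝ (Fin 2) × ℝ} (hq : liftObjective Z d q < m)
    (hq0 : paraboloidFn q < 0) : (sourceSolutions Z d).encard ≤ 5 := by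
  have hinj := liftForm_injective hm hq hq0
  have hsurj := (LinearMap.injective_iff_surjective_of_finrank_eq_finrank (by simp)).mp hinj
  have hmpos : 0 < m := lt_of_le_of_lt (Finset.sum_nonneg fun _ _ => abs_nonneg _) hq
  choose e he' using fun j : Fin 3 => hsurj (Pi.single j 1)
  have he : ∀ i j, liftForm (Z i) (e j) = if i = j then 1 else 0 := by
    intro i j
    have := congrFun (he' j) i
    rwa [LinearMap.pi_apply, Pi.single_apply] at this
  obtain ⟨o, ho'⟩ := hsurj fun j => -(‖Z j‖ ^ 2 - d j ^ 2)
  have ho : ∀ j, liftResidual Z d j o = 0 := by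
    intro j
    have := congrFun ho' j
    rw [LinearMap.pi_apply] at this
    rw [liftResidual, this]; ring
  -- The six vertices, with centre `o` and axes along the basis `e` dual to the forms.
  let P : Fin 3 × Bool → EuclideanSpace ℝ (Fin 2) × ℝ := fun x =>
    o + (if x.2 then m else -m) • e x.1
  have hmem : ∀ A ∈ sourceSolutions Z d, ∃ x, (A, ‖A‖ ^ 2) = P x := by
    intro A hA
    have htwo : ∀ {i j : Fin 3}, i ≠ j → liftResidual Z d i (A, ‖A‖ ^ 2) = 0 ∨
        liftResidual Z d j (A, ‖A‖ ^ 2) = 0 := fun hij =>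
      residual_eq_zero_or_of_inside hm hq hq0 he (hX A hA).le (paraboloidFn_lift A) hij
    obtain ⟨j, hj⟩ : ∃ j, ∀ i, i ≠ j → liftResidual Z d i (A, ‖A‖ ^ 2) = 0 := by
      by_cases h : ∃ j, liftResidual Z d j (A, ‖A‖ ^ 2) ≠ 0
      · obtain ⟨j, hj⟩ := h
        exact ⟨j, fun i hij => (htwo hij).resolve_right hj⟩
      · push Not at h
        exact ⟨0, fun i _ => h i⟩
    have habs : |liftResidual Z d j (A, ‖A‖ ^ 2)| = m := by
      rw [← hX A hA, liftObjective, Finset.sum_eq_single j (fun i _ hij => by rw [hj i hij, abs_zero])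
        (by simp)]
    have heq : ((A, ‖A‖ ^ 2) : EuclideanSpace ℝ (Fin 2) × ℝ) =
        o + liftResidual Z d j (A, ‖A‖ ^ 2) • e j := by
      apply hinj
      ext i
      rw [LinearMap.pi_apply, LinearMap.pi_apply, map_add, map_smul, he]
      have h1 := ho i
      rw [liftResidual] at h1
      split_ifs with hij
      · subst hij
        simp only [smul_eq_mul, mul_one, liftResidual]; linarith
      · have h2 := hj i hij
        rw [liftResidual] at h2
        simp only [smul_eq_mul, mul_zero]; linarith
    rcases (abs_eq hmpos.le).mp habs with h | h
    · exact ⟨(j, true), by rw [heq, h]; simp [P]⟩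
    · exact ⟨(j, false), by rw [heq, h]; simp [P]⟩
  obtain ⟨x₀, hx₀⟩ : ∃ x, paraboloidFn (P x) ≠ 0 := by
    by_contra! h
    -- Opposite vertices both on the paraboloid force the derivative of `paraboloidFn` at `o` along
    -- `e j` to vanish.
    have hlin : ∀ j, 2 * inner ℝ o.1 (e j).1 - (e j).2 = 0 := by
      intro j
      have h1 := h (j, true)
      have h2 := h (j, false)
      simp only [P, if_true, paraboloidFn_add_smul, Bool.false_eq_true, if_false] at h1 h2
      have : m * (2 * inner ℝ o.1 (e j).1 - (e j).2) = 0 := by linarith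
      exact (mul_eq_zero.mp this).resolve_left hmpos.ne'
    -- Every form equals 1 on the vertical vector `(0, 1)`, along which the derivative is -1.
    have hsum : ∑ j, e j = (0, 1) := by
      apply hinj
      ext i
      rw [map_sum, Finset.sum_apply]
      simp only [LinearMap.pi_apply, he]
      simp [liftForm_apply]
    have h1 : 2 * inner ℝ o.1 (∑ j, e j).1 - (∑ j, e j).2 = 0 := by
      rw [Prod.fst_sum, Prod.snd_sum, inner_sum, Finset.mul_sum, ← Finset.sum_sub_distrib]
      exact Finset.sum_eq_zero fun j _ => hlin j
    rw [hsum] at h1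
    simp at h1
  have hsub : sourceSolutions Z d ⊆
      (fun x => (P x).1) '' (({x₀}ᶜ : Finset (Fin 3 × Bool)) : Set (Fin 3 × Bool)) := by
    intro A hA
    obtain ⟨x, hx⟩ := hmem A hA
    refine ⟨x, ?_, by simp only [← hx]⟩
    have : x ≠ x₀ := by
      rintro rfl
      exact hx₀ (hx ▸ paraboloidFn_lift A)
    simpa using this
  refine (encard_le_encard hsub).trans ((encard_image_le _ _).trans ?_)
  rw [encard_coe_eq_coe_finsetCard, Finset.card_compl]
  simp

theorem theorem2 (Z : Fin 3 → EuclideanSpace ℝ (Fin 2)) (hZ : Function.Injective Z)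
    (d : Fin 3 → ℝ) : (sourceSolutions Z d).encard ≤ 5 := by
  rcases (sourceSolutions Z d).eq_empty_or_nonempty with h | ⟨A₀, hA₀⟩
  · simp [h]
  set m := liftObjective Z d (A₀, ‖A₀‖ ^ 2) with hmdef
  have hm : ∀ W : EuclideanSpace ℝ (Fin 2), m ≤ liftObjective Z d (W, ‖W‖ ^ 2) := fun W => by
    rw [hmdef, ← sourceObjective_eq, ← sourceObjective_eq]
    exact hA₀ W
  have hX : ∀ A ∈ sourceSolutions Z d, liftObjective Z d (A, ‖A‖ ^ 2) = m := fun A hA => by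
    refine le_antisymm ?_ (hm A)
    rw [hmdef, ← sourceObjective_eq, ← sourceObjective_eq]
    exact hA A₀
  by_cases hlow : ∃ q, liftObjective Z d q < m
  · obtain ⟨q, hq⟩ := hlow
    rcases (paraboloidFn_ne_zero hm hq).lt_or_gt with hq0 | hq0
    · exact encard_sourceSolutions_le_five_of_inside hm hX hq hq0
    · refine (encard_le_one_iff_subsingleton.mpr fun A hA B hB => ?_).trans (by norm_num)
      exact minimizer_unique_of_outside hm hq hq0 (hX A hA).le (hX B hB).le
  · push Not at hlow
    refine (encard_sourceSolutions_le_two hZ fun A hA q => ?_).trans (by norm_num)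
    rw [hX A hA]
    exact hlow q
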